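/- Let $n\ge 1$, let $\mathbb{M}_n$ be the space of complex $n\times n$ matrices and $\mathbb{M}_n^+$ its cone of positive semidefinite matrices. Let $\|\cdot\|$ be a symmetric norm on $\mathbb{M}_n$, i.e. a norm with $\|UAV\|=\|A\|$ for all $A\in\mathbb{M}_n$ and all unitaries $U,V\in\mathbb{M}_n$, and let $p>0$. For $A\in\mathbb{M}_n^+$ set $$\|A\|_!:=\begin{cases}\|A^{-p}\|^{-1/p} & \text{if } A \text{ is invertible},\\ 0 & \text{otherwise.}\end{cases}$$ Then $\|\cdot\|_!$ is a symmetric anti-norm on $\mathbb{M}_n^+$, that is, it is a non-negative continuous functional on $\mathbb{M}_n^+$ such that 1. $\|\lambda A\|_!=\lambda\|A\|_!$ for all $A\in\mathbb{M}_n^+$ and all reals $\lambda\ge 0$, 2. $\|UAU^*\|_!=\|A\|_!$ for all $A\in\mathbb{M}_n^+$ and all unitaries $U\in\mathbb{M}_n$, 3. $\|A+B\|_!\ge\|A\|_!+\|B\|_!$ for all $A,B\in\mathbb{M}_n^+$. (The symmetric anti-norms arising in this way are called derived anti-norms.) -/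

import Mathlib

/-- A symmetric norm on `M_n` (the complex `n × n` matrices): a norm, i.e. a seminorm over `ℂ` that
vanishes only at `0`, which is unitarily invariant, `‖U A V‖ = ‖A‖` for all unitaries `U`, `V`. -/
structure IsSymmetricNorm {n : ℕ} (N : Seminorm ℂ (Matrix (Fin n) (Fin n) ℂ)) : Prop where
  eq_zero_of_map_eq_zero : ∀ A, N A = 0 → A = 0
  unitarily_invariant : ∀ A, ∀ U ∈ Matrix.unitaryGroup (Fin n) ℂ,
    ∀ V ∈ Matrix.unitaryGroup (Fin n) ℂ, N (U * A * V) = N A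

open scoped ComplexOrder in
/-- A symmetric anti-norm on the cone `M_n^+` of positive semidefinite complex `n × n` matrices.
The functional is given by a function on all matrices, of which only the restriction to the cone
matters. -/
structure IsSymmetricAntiNorm {n : ℕ} (f : Matrix (Fin n) (Fin n) ℂ → ℝ) : Prop where
  nonneg : ∀ A, A.PosSemidef → 0 ≤ f A
  continuousOn : ContinuousOn f {A | A.PosSemidef}
  homogeneous : ∀ A, A.PosSemidef → ∀ r : ℝ, 0 ≤ r → f (r • A) = r * f A
  unitarily_invariant : ∀ A, A.PosSemidef → ∀ U ∈ Matrix.unitaryGroup (Fin n) ℂ,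
    f (U * A * U.conjTranspose) = f A
  superadditive : ∀ A B, A.PosSemidef → B.PosSemidef → f A + f B ≤ f (A + B)

open scoped MatrixOrder Classical in
/-- The derived anti-norm obtained from the norm `N` and the exponent `p`. For a positive definite
matrix `A`, the power `A ^ (-p)` is Mathlib's real power `CFC.rpow` of the continuous functional
calculus; for `A` in `M_n^+` the value is `N (A ^ (-p)) ^ (-1 / p)` if `A` is invertible and `0`
otherwise. -/
noncomputable def derivedAntiNorm {n : ℕ} (N : Seminorm ℂ (Matrix (Fin n) (Fin n) ℂ)) (p : ℝ)
    (A : Matrix (Fin n) (Fin n) ℂ) : ℝ :=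
  if IsUnit A then (N (A ^ (-p))) ^ (-1 / p) else 0

/-! For `p > 1` the map `A ↦ A ^ (-p)` need be neither convex nor antitone in the Loewner order, but
`A ↦ N (A ^ (-p))` is both on positive definite matrices. In an eigenbasis of `C`, `N (C ^ (-p))` is
the norm of the diagonal matrix of the `-p` powers of the diagonal of `C`. Pinching and monotonicity
on diagonals bound it by `N X` whenever the diagonal of `X` in that basis dominates these powers
(`exists_map_rpow_neg_le`). Jensen's inequality (`conjDiag_rpow_neg_le`) supplies the domination,
giving `map_rpow_neg_convex` and `map_rpow_neg_add_le`. Convexity and homogeneity yield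
superadditivity after normalising both summands; singular summands only need monotonicity.
Continuity follows from an order squeeze at positive definite points, and at singular points from a
bound by one diagonal entry that vanishes there. -/

open Matrix

/-! ### Unitary diagonalisation and functional calculus -/

/-- The matrix `U * diag(d) * U*`, for real diagonal entries `d`. -/
noncomputable def unitaryDiagonal {n : ℕ} (U : Matrix (Fin n) (Fin n) ℂ) (d : Fin n → ℝ) :
    Matrix (Fin n) (Fin n) ℂ :=
  U * diagonal (fun i => (d i : ℂ)) * Uᴴ

section UnitaryDiagonal

variable {n : ℕ} {U : Matrix (Fin n) (Fin n) ℂ} {d : Fin n → ℝ}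

lemma conjTranspose_mul_self_of_mem_unitaryGroup (hU : U ∈ unitaryGroup (Fin n) ℂ) :
    Uᴴ * U = 1 := mem_unitaryGroup_iff'.1 hU

lemma mul_conjTranspose_self_of_mem_unitaryGroup (hU : U ∈ unitaryGroup (Fin n) ℂ) :
    U * Uᴴ = 1 := mem_unitaryGroup_iff.1 hU

lemma conjTranspose_mem_unitaryGroup (hU : U ∈ unitaryGroup (Fin n) ℂ) :
    Uᴴ ∈ unitaryGroup (Fin n) ℂ := Unitary.star_mem hU

lemma conj_unitaryDiagonal (V U : Matrix (Fin n) (Fin n) ℂ) (d : Fin n → ℝ) :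
    V * unitaryDiagonal U d * Vᴴ = unitaryDiagonal (V * U) d := by
  simp [unitaryDiagonal, conjTranspose_mul, Matrix.mul_assoc]

lemma smul_unitaryDiagonal (r : ℝ) (U : Matrix (Fin n) (Fin n) ℂ) (d : Fin n → ℝ) :
    r • unitaryDiagonal U d = unitaryDiagonal U (fun i => r * d i) := by
  have : diagonal (fun i => ((r * d i : ℝ) : ℂ)) = r • diagonal (fun i => (d i : ℂ)) := by
    ext i j
    by_cases h : i = j
    · subst h; simp
    · simp [h]
  rw [unitaryDiagonal, unitaryDiagonal, this]
  simp

lemma unitaryDiagonal_one (hU : U ∈ unitaryGroup (Fin n) ℂ) :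
    unitaryDiagonal U (fun _ => 1) = 1 := by
  simp [unitaryDiagonal, mul_conjTranspose_self_of_mem_unitaryGroup hU]

lemma unitaryDiagonal_sub (U : Matrix (Fin n) (Fin n) ℂ) (d e : Fin n → ℝ) :
    unitaryDiagonal U d - unitaryDiagonal U e = unitaryDiagonal U (fun i => d i - e i) := by
  simp [unitaryDiagonal, ← Matrix.sub_mul, ← Matrix.mul_sub, diagonal_sub]

lemma isHermitian_unitaryDiagonal (U : Matrix (Fin n) (Fin n) ℂ) (d : Fin n → ℝ) :
    (unitaryDiagonal U d).IsHermitian := by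
  refine isHermitian_mul_mul_conjTranspose _ (isHermitian_diagonal_of_self_adjoint _ ?_)
  ext i
  simp

open scoped ComplexOrder in
lemma posSemidef_unitaryDiagonal (U : Matrix (Fin n) (Fin n) ℂ) (hd : ∀ i, 0 ≤ d i) :
    (unitaryDiagonal U d).PosSemidef := by
  refine PosSemidef.mul_mul_conjTranspose_same (PosSemidef.diagonal fun i => ?_) U
  simpa using hd i

lemma Matrix.IsHermitian.exists_eq_unitaryDiagonal {A : Matrix (Fin n) (Fin n) ℂ}
    (hA : A.IsHermitian) :
    A = unitaryDiagonal (hA.eigenvectorUnitary : Matrix (Fin n) (Fin n) ℂ) hA.eigenvalues := by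
  conv_lhs => rw [hA.spectral_theorem, Unitary.conjStarAlgAut_apply]
  rfl

/-- The real continuous functional calculus of `U * diag(d) * U*` acts on the entries of `d`. -/
lemma cfc_unitaryDiagonal (hU : U ∈ unitaryGroup (Fin n) ℂ) (d : Fin n → ℝ) (f : ℝ → ℝ) :
    cfc f (unitaryDiagonal U d) = unitaryDiagonal U (fun i => f (d i)) := by
  have hA := isHermitian_unitaryDiagonal U d
  have hV : (hA.eigenvectorUnitary : Matrix (Fin n) (Fin n) ℂ) ∈ unitaryGroup (Fin n) ℂ :=
    hA.eigenvectorUnitary.2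
  have h₀ := hA.exists_eq_unitaryDiagonal
  have h₁ : cfc f (unitaryDiagonal U d) =
      unitaryDiagonal (hA.eigenvectorUnitary : Matrix (Fin n) (Fin n) ℂ)
        (fun i => f (hA.eigenvalues i)) := by
    rw [hA.cfc_eq f, IsHermitian.cfc, Unitary.conjStarAlgAut_apply]
    rfl
  rw [h₁]
  generalize (hA.eigenvectorUnitary : Matrix (Fin n) (Fin n) ℂ) = V at *
  generalize hA.eigenvalues = e at *
  -- Two diagonalisations agree iff `Vᴴ * U` intertwines the diagonal matrices. The case `g = id`
  -- forces `e i = d j` wherever the entry of `Vᴴ * U` is nonzero, which gives the case `g = f`.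
  have key : ∀ g : ℝ → ℝ, unitaryDiagonal V (fun i => g (e i)) = unitaryDiagonal U (fun i => g (d i))
      ↔ ∀ i j, (g (e i) : ℂ) * (Vᴴ * U) i j = (Vᴴ * U) i j * g (d j) := by
    intro g
    have : unitaryDiagonal V (fun i => g (e i)) = unitaryDiagonal U (fun i => g (d i)) ↔
        diagonal (fun i => (g (e i) : ℂ)) * (Vᴴ * U) =
          (Vᴴ * U) * diagonal (fun i => (g (d i) : ℂ)) := by
      constructor
      · intro h
        have := congrArg (fun X => Vᴴ * X * U) h
        simp only [unitaryDiagonal] at this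
        calc _ = (Vᴴ * V) * diagonal (fun i => (g (e i) : ℂ)) * (Vᴴ * U) := by
              simp [conjTranspose_mul_self_of_mem_unitaryGroup hV]
          _ = Vᴴ * (V * diagonal (fun i => (g (e i) : ℂ)) * Vᴴ) * U := by
              simp only [Matrix.mul_assoc]
          _ = (Vᴴ * U) * diagonal (fun i => (g (d i) : ℂ)) * (Uᴴ * U) := by
              rw [this]; simp only [Matrix.mul_assoc]
          _ = _ := by simp [conjTranspose_mul_self_of_mem_unitaryGroup hU]
      · intro h
        calc unitaryDiagonal V (fun i => g (e i))
            = V * (diagonal (fun i => (g (e i) : ℂ)) * (Vᴴ * U)) * Uᴴ := by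
              simp only [unitaryDiagonal, Matrix.mul_assoc,
                mul_conjTranspose_self_of_mem_unitaryGroup hU, Matrix.mul_one]
          _ = (V * Vᴴ) * (U * diagonal (fun i => (g (d i) : ℂ)) * Uᴴ) := by
              rw [h]; simp only [Matrix.mul_assoc]
          _ = _ := by
              rw [mul_conjTranspose_self_of_mem_unitaryGroup hV, Matrix.one_mul]; rfl
    rw [this, ← Matrix.ext_iff]
    simp only [diagonal_mul, mul_diagonal]
  refine (key f).2 fun i j => ?_
  have h := (key id).1 h₀.symm i j
  simp only [id] at h
  rcases eq_or_ne ((Vᴴ * U) i j) 0 with h0 | h0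
  · simp [h0]
  · rw [mul_comm, mul_right_inj' h0] at h
    rw [Complex.ofReal_injective h, mul_comm]

open scoped MatrixOrder ComplexOrder in
lemma rpow_unitaryDiagonal (hU : U ∈ unitaryGroup (Fin n) ℂ) (hd : ∀ i, 0 ≤ d i) (q : ℝ) :
    unitaryDiagonal U d ^ q = unitaryDiagonal U (fun i => d i ^ q) := by
  rw [CFC.rpow_eq_cfc_real (nonneg_iff_posSemidef.2 (posSemidef_unitaryDiagonal U hd)),
    cfc_unitaryDiagonal hU]

open scoped ComplexOrder in
lemma Matrix.PosDef.exists_eq_unitaryDiagonal {A : Matrix (Fin n) (Fin n) ℂ} (hA : A.PosDef) :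
    ∃ U ∈ unitaryGroup (Fin n) ℂ, ∃ d : Fin n → ℝ, (∀ i, 0 < d i) ∧ A = unitaryDiagonal U d :=
  ⟨_, hA.1.eigenvectorUnitary.2, _, hA.eigenvalues_pos, hA.1.exists_eq_unitaryDiagonal⟩

end UnitaryDiagonal

/-! ### Diagonal entries in a unitary basis and Jensen's inequality -/

/-- The real part of the `i`-th diagonal entry of `W * X * W*`. -/
noncomputable def conjDiag {n : ℕ} (W X : Matrix (Fin n) (Fin n) ℂ) (i : Fin n) : ℝ :=
  ((W * X * Wᴴ) i i).re

section ConjDiag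

variable {n : ℕ} {U W : Matrix (Fin n) (Fin n) ℂ}

lemma conjDiag_add (W X Y : Matrix (Fin n) (Fin n) ℂ) (i : Fin n) :
    conjDiag W (X + Y) i = conjDiag W X i + conjDiag W Y i := by
  simp [conjDiag, Matrix.mul_add, Matrix.add_mul]

lemma conjDiag_smul (W : Matrix (Fin n) (Fin n) ℂ) (r : ℝ) (X : Matrix (Fin n) (Fin n) ℂ)
    (i : Fin n) : conjDiag W (r • X) i = r * conjDiag W X i := by
  simp [conjDiag]

lemma conjDiag_unitaryDiagonal (W U : Matrix (Fin n) (Fin n) ℂ) (d : Fin n → ℝ) (i : Fin n) :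
    conjDiag W (unitaryDiagonal U d) i = ∑ j, Complex.normSq ((W * U) i j) * d j := by
  rw [conjDiag, conj_unitaryDiagonal, unitaryDiagonal, Matrix.mul_apply, Complex.re_sum]
  refine Finset.sum_congr rfl fun j _ => ?_
  rw [mul_diagonal, conjTranspose_apply, mul_right_comm, Complex.star_def, Complex.mul_conj,
    ← Complex.ofReal_mul, Complex.ofReal_re]

/-- Makes the weights in `conjDiag_unitaryDiagonal` a probability vector, as Jensen's inequality
requires. -/
lemma sum_normSq_row (hU : U ∈ unitaryGroup (Fin n) ℂ) (i : Fin n) :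
    ∑ j, Complex.normSq (U i j) = 1 := by
  have h := conjDiag_unitaryDiagonal 1 U (fun _ => 1) i
  rw [unitaryDiagonal_one hU] at h
  simpa [conjDiag] using h.symm

open scoped ComplexOrder in
lemma Matrix.PosSemidef.conjDiag_nonneg {A : Matrix (Fin n) (Fin n) ℂ} (hA : A.PosSemidef)
    (W : Matrix (Fin n) (Fin n) ℂ) (i : Fin n) : 0 ≤ conjDiag W A i :=
  (Complex.le_def.1 (hA.mul_mul_conjTranspose_same W).diag_nonneg).1

open scoped ComplexOrder in
lemma Matrix.PosDef.conjDiag_pos {A : Matrix (Fin n) (Fin n) ℂ} (hA : A.PosDef)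
    (hW : W ∈ unitaryGroup (Fin n) ℂ) (i : Fin n) : 0 < conjDiag W A i := by
  obtain ⟨U, hU, d, hd, rfl⟩ := hA.exists_eq_unitaryDiagonal
  rw [conjDiag_unitaryDiagonal]
  have hs := sum_normSq_row (mul_mem hW hU) i
  have h0 : ∀ j ∈ Finset.univ, 0 ≤ Complex.normSq ((W * U) i j) * d j :=
    fun j _ => mul_nonneg (Complex.normSq_nonneg _) (hd j).le
  refine lt_of_le_of_ne (Finset.sum_nonneg h0) fun h => ?_
  rw [eq_comm, Finset.sum_eq_zero_iff_of_nonneg h0] at h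
  rw [Finset.sum_eq_zero fun j hj => (mul_eq_zero.1 (h j hj)).resolve_right (hd j).ne'] at hs
  exact zero_ne_one hs

/-- The function is `exp (-p log x)`: the increasing convex `exp` after the convex `-p log`. -/
lemma convexOn_rpow_neg {p : ℝ} (hp : 0 ≤ p) :
    ConvexOn ℝ (Set.Ioi 0) fun x : ℝ => x ^ (-p) := by
  have h1 : ConvexOn ℝ (Set.Ioi 0) fun x : ℝ => p * -Real.log x :=
    (strictConcaveOn_log_Ioi.concaveOn.neg).smul hp
  have himg : Convex ℝ ((fun x : ℝ => p * -Real.log x) '' Set.Ioi 0) := by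
    refine ((isPreconnected_Ioi).image _ ?_).convex
    exact continuousOn_const.mul
      (Real.continuousOn_log.mono fun x (hx : 0 < x) => hx.ne').neg
  have h2 := (convexOn_exp.subset (Set.subset_univ _) himg).comp h1
    (Real.exp_monotone.monotoneOn _)
  refine h2.congr fun x (hx : 0 < x) => ?_
  simp only [Function.comp_apply]
  rw [Real.rpow_def_of_pos hx]
  ring_nf

open scoped ComplexOrder MatrixOrder in
/-- Jensen's inequality for the diagonal entries of a negative power. -/
lemma Matrix.PosDef.conjDiag_rpow_neg_le {A : Matrix (Fin n) (Fin n) ℂ} (hA : A.PosDef)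
    (hW : W ∈ unitaryGroup (Fin n) ℂ) {p : ℝ} (hp : 0 ≤ p) (i : Fin n) :
    conjDiag W A i ^ (-p) ≤ conjDiag W (A ^ (-p)) i := by
  obtain ⟨U, hU, d, hd, rfl⟩ := hA.exists_eq_unitaryDiagonal
  rw [rpow_unitaryDiagonal hU fun i => (hd i).le, conjDiag_unitaryDiagonal,
    conjDiag_unitaryDiagonal]
  exact (convexOn_rpow_neg hp).map_sum_le (fun j _ => Complex.normSq_nonneg _)
    (sum_normSq_row (mul_mem hW hU) i) fun j _ => hd j

end ConjDiag

/-! ### Symmetric norms: pinching, monotonicity, negative powers -/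

section SymmetricNorm

variable {n : ℕ} {N : Seminorm ℂ (Matrix (Fin n) (Fin n) ℂ)}

lemma diagonal_mem_unitaryGroup {u : Fin n → ℂ} (hu : ∀ i, u i * star (u i) = 1) :
    diagonal u ∈ unitaryGroup (Fin n) ℂ := by
  rw [mem_unitaryGroup_iff, star_eq_conjTranspose, diagonal_conjTranspose, diagonal_mul_diagonal,
    ← diagonal_one]
  exact congrArg _ (funext hu)

lemma Seminorm.map_real_smul (N : Seminorm ℂ (Matrix (Fin n) (Fin n) ℂ)) (r : ℝ)
    (X : Matrix (Fin n) (Fin n) ℂ) : N (r • X) = |r| * N X := by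
  rw [← Complex.coe_smul, map_smul_eq_mul, Complex.norm_real, Real.norm_eq_abs]

/-- Pinching to the diagonal does not increase a symmetric norm. -/
lemma IsSymmetricNorm.map_diagonal_diag_le (hN : IsSymmetricNorm N)
    (X : Matrix (Fin n) (Fin n) ℂ) : N (diagonal X.diag) ≤ N X := by
  rcases Nat.eq_zero_or_pos n with rfl | hn
  · exact le_of_eq (congrArg N (Subsingleton.elim _ _))
  have : NeZero n := ⟨hn.ne'⟩
  let c : Fin n → ZMod n := fun i => ((i : ℕ) : ZMod n)
  have hc : Function.Injective c := by
    intro i j h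
    have h' := (ZMod.natCast_eq_natCast_iff' _ _ _).1 h
    rw [Nat.mod_eq_of_lt i.2, Nat.mod_eq_of_lt j.2] at h'
    exact Fin.ext h'
  let ψ : AddChar (ZMod n) ℂ := ZMod.stdAddChar
  have hstar : ∀ x, star (ψ x) = ψ (-x) := by
    intro x
    simp only [ψ, AddChar.map_neg_eq_inv, ZMod.stdAddChar_apply]
    rw [← Circle.coe_inv, Circle.coe_inv_eq_conj]
    rfl
  have hψ : ∀ x, ψ x * star (ψ x) = 1 := by
    intro x
    rw [hstar, ← AddChar.map_add_eq_mul, add_neg_cancel, AddChar.map_zero_eq_one]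
  -- Averaging the conjugates of `X` by these character matrices kills each off-diagonal entry, by
  -- orthogonality and injectivity of `c`.
  let D : ZMod n → Matrix (Fin n) (Fin n) ℂ := fun k => diagonal fun i => ψ (k * c i)
  have hD : ∀ k, D k ∈ unitaryGroup (Fin n) ℂ := fun k =>
    diagonal_mem_unitaryGroup fun i => hψ _
  have hsum : ∑ k, D k * X * (D k)ᴴ = (n : ℂ) • diagonal X.diag := by
    ext i j
    have : ∀ k, (D k * X * (D k)ᴴ) i j = X i j * ψ (k * (c i - c j)) := by
      intro k
      simp only [D, diagonal_conjTranspose, mul_diagonal, diagonal_mul, Pi.star_apply]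
      rw [hstar, mul_sub, sub_eq_add_neg, AddChar.map_add_eq_mul]
      ring
    rw [Matrix.sum_apply]
    simp only [this]
    rw [← Finset.mul_sum, AddChar.sum_mulShift _ (ZMod.isPrimitive_stdAddChar n)]
    by_cases hij : i = j
    · subst hij; simp [mul_comm]
    · simp [hij, sub_eq_zero, hc.eq_iff]
  have hle : N (∑ k, D k * X * (D k)ᴴ) ≤ n * N X := by
    refine (Finset.le_sum_of_subadditive N (map_zero N).le (map_add_le_add N) _ _).trans (le_of_eq ?_)
    simp [hN.unitarily_invariant X _ (hD _) _ (conjTranspose_mem_unitaryGroup (hD _)), ZMod.card]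
  rw [hsum, map_smul_eq_mul, Complex.norm_natCast] at hle
  exact le_of_mul_le_mul_left hle (by exact_mod_cast hn)

/-- Writes a factor in `[0, 1]` as the mean of a unit complex number and its conjugate, so that
shrinking diagonal entries becomes averaging two unitary multiples. -/
lemma exists_unit_re_eq {k : ℝ} (h0 : 0 ≤ k) (h1 : k ≤ 1) :
    ∃ u : ℂ, u * star u = 1 ∧ u + star u = 2 * k := by
  refine ⟨⟨k, √(1 - k ^ 2)⟩, ?_, ?_⟩
  · have h : √(1 - k ^ 2) * √(1 - k ^ 2) = 1 - k ^ 2 := Real.mul_self_sqrt (by nlinarith)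
    rw [Complex.star_def, Complex.mul_conj, Complex.normSq_mk, h]
    norm_num [← sq]
  · rw [Complex.star_def, Complex.add_conj]
    simp

/-- A symmetric norm is monotone on diagonal matrices with nonnegative entries. -/
lemma IsSymmetricNorm.map_diagonal_mono (hN : IsSymmetricNorm N) {c d : Fin n → ℝ}
    (h0 : ∀ i, 0 ≤ c i) (hcd : ∀ i, c i ≤ d i) :
    N (diagonal fun i => (c i : ℂ)) ≤ N (diagonal fun i => (d i : ℂ)) := by
  have hex : ∀ i, ∃ u : ℂ, u * star u = 1 ∧ u * d i + star u * d i = 2 * c i := by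
    intro i
    obtain ⟨u, hu, hu'⟩ := exists_unit_re_eq (k := c i / d i)
      (div_nonneg (h0 i) ((h0 i).trans (hcd i)))
      (div_le_one_of_le₀ (hcd i) ((h0 i).trans (hcd i)))
    refine ⟨u, hu, ?_⟩
    rw [← add_mul, hu']
    -- If `d i = 0`, the quotient is `0` by convention, and `c i = 0` is forced.
    rcases eq_or_ne (d i) 0 with h | h
    · simp [h, le_antisymm (h ▸ hcd i) (h0 i)]
    · rw [Complex.ofReal_div, mul_assoc, div_mul_cancel₀ _ (Complex.ofReal_ne_zero.2 h)]
  choose u hu hud using hex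
  have hU := diagonal_mem_unitaryGroup hu
  have hU' := conjTranspose_mem_unitaryGroup hU
  set D : Matrix (Fin n) (Fin n) ℂ := diagonal fun i => (d i : ℂ) with hD
  have hsum : diagonal u * D * 1 + (diagonal u)ᴴ * D * 1 = (2 : ℂ) • diagonal fun i => (c i : ℂ) := by
    rw [diagonal_conjTranspose, hD]
    simp only [Matrix.mul_one, diagonal_mul_diagonal, diagonal_add, ← diagonal_smul]
    exact congrArg _ (funext hud)
  have h := map_add_le_add N (diagonal u * D * 1) ((diagonal u)ᴴ * D * 1)
  rw [hsum, map_smul_eq_mul, hN.unitarily_invariant _ _ hU _ (one_mem _),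
    hN.unitarily_invariant _ _ hU' _ (one_mem _)] at h
  norm_num at h
  linarith

open scoped ComplexOrder in
/-- A symmetric norm of a positive semidefinite matrix dominates that of any nonnegative diagonal
matrix lying below one of its diagonals. -/
lemma IsSymmetricNorm.map_diagonal_le (hN : IsSymmetricNorm N) {X W : Matrix (Fin n) (Fin n) ℂ}
    (hX : X.PosSemidef) (hW : W ∈ unitaryGroup (Fin n) ℂ) {c : Fin n → ℝ} (h0 : ∀ i, 0 ≤ c i)
    (hc : ∀ i, c i ≤ conjDiag W X i) : N (diagonal fun i => (c i : ℂ)) ≤ N X := by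
  refine (hN.map_diagonal_mono h0 hc).trans ?_
  have : (diagonal fun i => (conjDiag W X i : ℂ)) = diagonal (W * X * Wᴴ).diag := by
    congr 1
    funext i
    exact Complex.ext rfl
      (Complex.le_def.1 (hX.mul_mul_conjTranspose_same W).diag_nonneg).2
  rw [this]
  exact (hN.map_diagonal_diag_le _).trans
    (hN.unitarily_invariant X W hW _ (conjTranspose_mem_unitaryGroup hW)).le

lemma IsSymmetricNorm.map_unitaryDiagonal (hN : IsSymmetricNorm N)
    {U : Matrix (Fin n) (Fin n) ℂ} (hU : U ∈ unitaryGroup (Fin n) ℂ) (d : Fin n → ℝ) :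
    N (unitaryDiagonal U d) = N (diagonal fun i => (d i : ℂ)) :=
  hN.unitarily_invariant _ U hU _ (conjTranspose_mem_unitaryGroup hU)

open scoped ComplexOrder MatrixOrder in
/-- Every positive definite `C` is diagonalised by a unitary `W` in such a way that a symmetric
norm of `C ^ (-p)` can be bounded by comparing diagonals. -/
lemma IsSymmetricNorm.exists_map_rpow_neg_le (hN : IsSymmetricNorm N)
    {C : Matrix (Fin n) (Fin n) ℂ} (hC : C.PosDef) (p : ℝ) :
    ∃ W ∈ unitaryGroup (Fin n) ℂ, ∀ X : Matrix (Fin n) (Fin n) ℂ, X.PosSemidef →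
      (∀ i, conjDiag W C i ^ (-p) ≤ conjDiag W X i) → N (C ^ (-p)) ≤ N X := by
  obtain ⟨U, hU, d, hd, rfl⟩ := hC.exists_eq_unitaryDiagonal
  refine ⟨Uᴴ, conjTranspose_mem_unitaryGroup hU, fun X hX h => ?_⟩
  rw [rpow_unitaryDiagonal hU fun i => (hd i).le, hN.map_unitaryDiagonal hU]
  refine hN.map_diagonal_le hX (conjTranspose_mem_unitaryGroup hU)
    (fun i => Real.rpow_nonneg (hd i).le _) fun i => ?_
  have : conjDiag Uᴴ (unitaryDiagonal U d) i = d i := by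
    rw [conjDiag_unitaryDiagonal, conjTranspose_mul_self_of_mem_unitaryGroup hU]
    simp [Matrix.one_apply, apply_ite Complex.normSq]
  simpa [this] using h i

open scoped ComplexOrder MatrixOrder in
lemma posSemidef_rpow (A : Matrix (Fin n) (Fin n) ℂ) (q : ℝ) : (A ^ q).PosSemidef :=
  nonneg_iff_posSemidef.1 CFC.rpow_nonneg

open scoped ComplexOrder MatrixOrder in
/-- Convexity of `A ↦ N (A ^ (-p))`. -/
lemma IsSymmetricNorm.map_rpow_neg_convex (hN : IsSymmetricNorm N)
    {A B : Matrix (Fin n) (Fin n) ℂ} (hA : A.PosDef) (hB : B.PosDef) {p : ℝ} (hp : 0 ≤ p)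
    {a b : ℝ} (ha : 0 < a) (hb : 0 < b) (hab : a + b = 1) :
    N ((a • A + b • B) ^ (-p)) ≤ a * N (A ^ (-p)) + b * N (B ^ (-p)) := by
  have hC : (a • A + b • B).PosDef := (hA.smul ha).add (hB.smul hb)
  obtain ⟨W, hW, h⟩ := hN.exists_map_rpow_neg_le hC p
  refine (h (a • A ^ (-p) + b • B ^ (-p))
    (((posSemidef_rpow A _).smul ha.le).add ((posSemidef_rpow B _).smul hb.le)) fun i => ?_).trans ?_
  · rw [conjDiag_add, conjDiag_add]
    simp only [conjDiag_smul]
    -- Scalar convexity at the diagonal entries of `A` and `B` in the eigenbasis of `a • A + b • B`;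
    -- Jensen then treats each term.
    refine ((convexOn_rpow_neg hp).2 (hA.conjDiag_pos hW i) (hB.conjDiag_pos hW i) ha.le hb.le
      hab).trans ?_
    simp only [smul_eq_mul]
    gcongr
    · exact hA.conjDiag_rpow_neg_le hW hp i
    · exact hB.conjDiag_rpow_neg_le hW hp i
  · refine (map_add_le_add N _ _).trans ?_
    rw [N.map_real_smul, N.map_real_smul, abs_of_pos ha, abs_of_pos hb]

-- In an eigenbasis of `A + B`, adding `B` raises the diagonal of `A`, hence lowers its `-p` powers;
-- Jensen for `A` finishes.
open scoped ComplexOrder MatrixOrder in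
lemma IsSymmetricNorm.map_rpow_neg_add_le (hN : IsSymmetricNorm N)
    {A B : Matrix (Fin n) (Fin n) ℂ} (hA : A.PosDef) (hB : B.PosSemidef) {p : ℝ} (hp : 0 ≤ p) :
    N ((A + B) ^ (-p)) ≤ N (A ^ (-p)) := by
  obtain ⟨W, hW, h⟩ := hN.exists_map_rpow_neg_le (hA.add_posSemidef hB) p
  refine h _ (posSemidef_rpow A _) fun i => ?_
  refine le_trans ?_ (hA.conjDiag_rpow_neg_le hW hp i)
  rw [conjDiag_add]
  exact Real.rpow_le_rpow_of_nonpos (hA.conjDiag_pos hW i)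
    (le_add_of_nonneg_right (hB.conjDiag_nonneg W i)) (neg_nonpos.2 hp)

end SymmetricNorm

/-! ### Algebraic properties of the derived anti-norm -/

section DerivedAntiNorm

open scoped ComplexOrder MatrixOrder

variable {n : ℕ} {N : Seminorm ℂ (Matrix (Fin n) (Fin n) ℂ)} {p : ℝ}

lemma derivedAntiNorm_of_posDef (N : Seminorm ℂ (Matrix (Fin n) (Fin n) ℂ)) (p : ℝ)
    {A : Matrix (Fin n) (Fin n) ℂ} (hA : A.PosDef) :
    derivedAntiNorm N p A = N (A ^ (-p)) ^ (-1 / p) :=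
  if_pos hA.isUnit

lemma derivedAntiNorm_of_not_posDef (N : Seminorm ℂ (Matrix (Fin n) (Fin n) ℂ)) (p : ℝ)
    {A : Matrix (Fin n) (Fin n) ℂ} (hA : A.PosSemidef) (h : ¬ A.PosDef) :
    derivedAntiNorm N p A = 0 :=
  if_neg fun hu => h (hA.posDef_iff_isUnit.2 hu)

lemma derivedAntiNorm_nonneg (N : Seminorm ℂ (Matrix (Fin n) (Fin n) ℂ)) (p : ℝ)
    (A : Matrix (Fin n) (Fin n) ℂ) : 0 ≤ derivedAntiNorm N p A := by
  unfold derivedAntiNorm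
  split_ifs
  · exact Real.rpow_nonneg (apply_nonneg N _) _
  · exact le_rfl

/-- The empty matrix is invertible, so the value rests on the convention that `0` to a nonzero real
power is `0`. -/
lemma derivedAntiNorm_of_eq_zero (hp : 0 < p) {n : ℕ} (hn : n = 0)
    (N : Seminorm ℂ (Matrix (Fin n) (Fin n) ℂ)) (A : Matrix (Fin n) (Fin n) ℂ) :
    derivedAntiNorm N p A = 0 := by
  subst hn
  rw [derivedAntiNorm, Subsingleton.elim (A ^ (-p)) 0, map_zero, Real.zero_rpow, ite_self]
  exact (div_neg_of_neg_of_pos (by norm_num) hp).ne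

lemma IsSymmetricNorm.map_rpow_pos [NeZero n] (hN : IsSymmetricNorm N)
    {A : Matrix (Fin n) (Fin n) ℂ} (hA : A.PosDef) (q : ℝ) : 0 < N (A ^ q) := by
  refine lt_of_le_of_ne (apply_nonneg N _) fun h => ?_
  obtain ⟨U, hU, d, hd, rfl⟩ := hA.exists_eq_unitaryDiagonal
  rw [rpow_unitaryDiagonal hU fun i => (hd i).le, hN.map_unitaryDiagonal hU] at h
  have h0 := congrFun (congrFun (hN.eq_zero_of_map_eq_zero _ h.symm) 0) 0
  simp [(Real.rpow_pos_of_pos (hd 0) q).ne'] at h0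

lemma IsSymmetricNorm.derivedAntiNorm_pos [NeZero n] (hN : IsSymmetricNorm N)
    {A : Matrix (Fin n) (Fin n) ℂ} (hA : A.PosDef) : 0 < derivedAntiNorm N p A := by
  rw [derivedAntiNorm_of_posDef N p hA]
  exact Real.rpow_pos_of_pos (hN.map_rpow_pos hA _) _

lemma derivedAntiNorm_rpow_neg (hp : 0 < p) {A : Matrix (Fin n) (Fin n) ℂ} (hA : A.PosDef) :
    derivedAntiNorm N p A ^ (-p) = N (A ^ (-p)) := by
  rw [derivedAntiNorm_of_posDef N p hA, ← Real.rpow_mul (apply_nonneg N _)]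
  rw [show -1 / p * -p = 1 by field_simp, Real.rpow_one]

lemma smul_rpow {A : Matrix (Fin n) (Fin n) ℂ} (hA : A.PosDef) {r : ℝ} (hr : 0 ≤ r) (q : ℝ) :
    (r • A) ^ q = r ^ q • A ^ q := by
  obtain ⟨U, hU, d, hd, rfl⟩ := hA.exists_eq_unitaryDiagonal
  rw [smul_unitaryDiagonal, rpow_unitaryDiagonal hU fun i => (hd i).le,
    rpow_unitaryDiagonal hU fun i => mul_nonneg hr (hd i).le, smul_unitaryDiagonal]
  simp only [Real.mul_rpow hr (hd _).le]

lemma derivedAntiNorm_smul (hp : 0 < p) {A : Matrix (Fin n) (Fin n) ℂ} (hA : A.PosSemidef) {r : ℝ}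
    (hr : 0 ≤ r) : derivedAntiNorm N p (r • A) = r * derivedAntiNorm N p A := by
  rcases Nat.eq_zero_or_pos n with hn | hn
  · simp [derivedAntiNorm_of_eq_zero hp hn]
  have : NeZero n := ⟨hn.ne'⟩
  rcases hr.eq_or_lt with rfl | hr'
  · simp [derivedAntiNorm]
  by_cases h : A.PosDef
  · rw [derivedAntiNorm_of_posDef N p h, derivedAntiNorm_of_posDef N p (h.smul hr'),
      smul_rpow h hr, N.map_real_smul, abs_of_pos (Real.rpow_pos_of_pos hr' _),
      Real.mul_rpow (Real.rpow_nonneg hr _) (apply_nonneg N _), ← Real.rpow_mul hr,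
      show -p * (-1 / p) = 1 by field_simp, Real.rpow_one]
  · rw [derivedAntiNorm_of_not_posDef N p hA h, derivedAntiNorm_of_not_posDef N p (hA.smul hr),
      mul_zero]
    intro h'
    have := h'.smul (inv_pos.2 hr')
    rw [smul_smul, inv_mul_cancel₀ hr'.ne', one_smul] at this
    exact h this

lemma IsSymmetricNorm.derivedAntiNorm_conj (hN : IsSymmetricNorm N)
    {A U : Matrix (Fin n) (Fin n) ℂ} (hA : A.PosSemidef) (hU : U ∈ unitaryGroup (Fin n) ℂ) :
    derivedAntiNorm N p (U * A * Uᴴ) = derivedAntiNorm N p A := by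
  have hunit : IsUnit U := (Unitary.toUnits ⟨U, hU⟩).isUnit
  have hpd : (U * A * Uᴴ).PosDef ↔ A.PosDef := hunit.posDef_star_right_conjugate_iff
  by_cases h : A.PosDef
  · rw [derivedAntiNorm_of_posDef N p h, derivedAntiNorm_of_posDef N p (hpd.2 h)]
    obtain ⟨V, hV, d, hd, rfl⟩ := h.exists_eq_unitaryDiagonal
    rw [conj_unitaryDiagonal, rpow_unitaryDiagonal hV fun i => (hd i).le,
      rpow_unitaryDiagonal (mul_mem hU hV) fun i => (hd i).le, hN.map_unitaryDiagonal hV,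
      hN.map_unitaryDiagonal (mul_mem hU hV)]
  · rw [derivedAntiNorm_of_not_posDef N p hA h,
      derivedAntiNorm_of_not_posDef N p (hA.mul_mul_conjTranspose_same U) (hpd.not.2 h)]

lemma IsSymmetricNorm.derivedAntiNorm_le_add [NeZero n] (hN : IsSymmetricNorm N) (hp : 0 < p)
    {A B : Matrix (Fin n) (Fin n) ℂ} (hA : A.PosSemidef) (hB : B.PosSemidef) :
    derivedAntiNorm N p A ≤ derivedAntiNorm N p (A + B) := by
  by_cases h : A.PosDef
  · rw [derivedAntiNorm_of_posDef N p h, derivedAntiNorm_of_posDef N p (h.add_posSemidef hB)]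
    exact Real.rpow_le_rpow_of_nonpos (hN.map_rpow_pos (h.add_posSemidef hB) _)
      (hN.map_rpow_neg_add_le h hB hp.le) (div_neg_of_neg_of_pos (by norm_num) hp).le
  · rw [derivedAntiNorm_of_not_posDef N p hA h]
    exact derivedAntiNorm_nonneg N p _

lemma IsSymmetricNorm.derivedAntiNorm_superadditive (hN : IsSymmetricNorm N) (hp : 0 < p)
    {A B : Matrix (Fin n) (Fin n) ℂ} (hA : A.PosSemidef) (hB : B.PosSemidef) :
    derivedAntiNorm N p A + derivedAntiNorm N p B ≤ derivedAntiNorm N p (A + B) := by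
  rcases Nat.eq_zero_or_pos n with hn | hn
  · simp [derivedAntiNorm_of_eq_zero hp hn]
  have : NeZero n := ⟨hn.ne'⟩
  by_cases hA' : A.PosDef
  swap
  · rw [derivedAntiNorm_of_not_posDef N p hA hA', zero_add, add_comm A]
    exact hN.derivedAntiNorm_le_add hp hB hA
  by_cases hB' : B.PosDef
  swap
  · rw [derivedAntiNorm_of_not_posDef N p hB hB', add_zero]
    exact hN.derivedAntiNorm_le_add hp hA hB
  have hα := hN.derivedAntiNorm_pos (p := p) hA'
  have hβ := hN.derivedAntiNorm_pos (p := p) hB'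
  have hC := hN.derivedAntiNorm_pos (p := p) (hA'.add hB')
  set α := derivedAntiNorm N p A with hαdef
  set β := derivedAntiNorm N p B with hβdef
  have hs : 0 < α + β := add_pos hα hβ
  -- Both normalised matrices have derived anti-norm `1`; these weights turn their convex
  -- combination into `(α + β)⁻¹ • (A + B)`.
  have hconv := hN.map_rpow_neg_convex (hA'.smul (inv_pos.2 hα)) (hB'.smul (inv_pos.2 hβ)) hp.le
    (div_pos hα hs) (div_pos hβ hs) (by rw [← add_div, div_self hs.ne'])
  have hone : ∀ {X : Matrix (Fin n) (Fin n) ℂ}, X.PosDef → 0 < derivedAntiNorm N p X →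
      N (((derivedAntiNorm N p X)⁻¹ • X) ^ (-p)) = 1 := by
    intro X hX h0
    rw [← derivedAntiNorm_rpow_neg hp (hX.smul (inv_pos.2 h0)),
      derivedAntiNorm_smul hp hX.posSemidef (inv_pos.2 h0).le, inv_mul_cancel₀ h0.ne',
      Real.one_rpow]
  have hsum : (α / (α + β)) • α⁻¹ • A + (β / (α + β)) • β⁻¹ • B = (α + β)⁻¹ • (A + B) := by
    rw [smul_smul, smul_smul, smul_add]
    congr 2 <;> field_simp
  rw [hsum, hone hA' hα, hone hB' hβ, mul_one, mul_one, ← add_div, div_self hs.ne',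
    ← derivedAntiNorm_rpow_neg hp ((hA'.add hB').smul (inv_pos.2 hs)),
    derivedAntiNorm_smul hp (hA.add hB) (inv_pos.2 hs).le] at hconv
  have h1 : 1 ≤ (α + β)⁻¹ * derivedAntiNorm N p (A + B) := by
    by_contra! hlt
    exact absurd hconv (not_le.2 (Real.one_lt_rpow_of_pos_of_lt_one_of_neg
      (mul_pos (inv_pos.2 hs) hC) hlt (neg_lt_zero.2 hp)))
  rwa [inv_mul_eq_div, one_le_div hs] at h1

lemma IsSymmetricNorm.derivedAntiNorm_mono (hN : IsSymmetricNorm N) (hp : 0 < p)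
    {A B : Matrix (Fin n) (Fin n) ℂ} (hA : A.PosSemidef) (hAB : A ≤ B) :
    derivedAntiNorm N p A ≤ derivedAntiNorm N p B := by
  have h := hN.derivedAntiNorm_superadditive hp hA (le_iff.1 hAB)
  rw [add_sub_cancel] at h
  exact (le_add_of_nonneg_right (derivedAntiNorm_nonneg N p _)).trans h

/-! ### Continuity on the cone -/

/-- The derived anti-norm is controlled by each single diagonal entry. -/
lemma IsSymmetricNorm.derivedAntiNorm_le_conjDiag [NeZero n] (hN : IsSymmetricNorm N) (hp : 0 < p)
    {A W : Matrix (Fin n) (Fin n) ℂ} (hA : A.PosSemidef) (hW : W ∈ unitaryGroup (Fin n) ℂ)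
    (i : Fin n) :
    derivedAntiNorm N p A ≤ conjDiag W A i * N (diagonal (Pi.single i 1)) ^ (-1 / p) := by
  by_cases h : A.PosDef
  swap
  · rw [derivedAntiNorm_of_not_posDef N p hA h]
    exact mul_nonneg (hA.conjDiag_nonneg W i) (Real.rpow_nonneg (apply_nonneg N _) _)
  have ha := h.conjDiag_pos hW i
  set a := conjDiag W A i with hadef
  have hE : 0 < N (diagonal (Pi.single i 1)) := by
    refine lt_of_le_of_ne (apply_nonneg N _) fun h0 => ?_
    have := congrFun (congrFun (hN.eq_zero_of_map_eq_zero _ h0.symm) i) i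
    simp at this
  -- `A ^ (-p)` is compared with the diagonal matrix whose only nonzero entry is `a ^ (-p)`, at
  -- position `i`.
  have hle : a ^ (-p) * N (diagonal (Pi.single i 1)) ≤ N (A ^ (-p)) := by
    have hc : (diagonal fun j => ((Pi.single i (a ^ (-p)) : Fin n → ℝ) j : ℂ)) =
        (a ^ (-p)) • (diagonal (Pi.single i 1) : Matrix (Fin n) (Fin n) ℂ) := by
      rw [← diagonal_smul]
      congr 1
      funext j
      by_cases hj : j = i
      · subst hj; simp
      · simp [hj]
    have := hN.map_diagonal_le (c := Pi.single i (a ^ (-p))) (posSemidef_rpow A (-p)) hW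
      (fun j => ?_) fun j => ?_
    · rwa [hc, N.map_real_smul, abs_of_pos (Real.rpow_pos_of_pos ha _)] at this
    · by_cases hj : j = i
      · subst hj; simpa using Real.rpow_nonneg ha.le _
      · simp [hj]
    · by_cases hj : j = i
      · subst hj; simpa using h.conjDiag_rpow_neg_le hW hp.le j
      · simpa [hj] using (posSemidef_rpow A (-p)).conjDiag_nonneg W j
  rw [derivedAntiNorm_of_posDef N p h]
  refine (Real.rpow_le_rpow_of_nonpos (mul_pos (Real.rpow_pos_of_pos ha _) hE) hle
    (div_neg_of_neg_of_pos (by norm_num) hp).le).trans (le_of_eq ?_)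
  rw [Real.mul_rpow (Real.rpow_nonneg ha.le _) hE.le, ← Real.rpow_mul ha.le,
    show -p * (-1 / p) = 1 by field_simp, Real.rpow_one]

/-- A singular matrix has a zero eigenvalue, which appears on the diagonal in an eigenbasis. -/
lemma Matrix.PosSemidef.exists_conjDiag_eq_zero {A : Matrix (Fin n) (Fin n) ℂ}
    (hA : A.PosSemidef) (h : ¬ A.PosDef) :
    ∃ W ∈ unitaryGroup (Fin n) ℂ, ∃ i, conjDiag W A i = 0 := by
  rw [hA.1.posDef_iff_eigenvalues_pos] at h
  push Not at h
  obtain ⟨i, hi⟩ := h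
  have hU : (hA.1.eigenvectorUnitary : Matrix (Fin n) (Fin n) ℂ) ∈ unitaryGroup (Fin n) ℂ :=
    hA.1.eigenvectorUnitary.2
  refine ⟨_, conjTranspose_mem_unitaryGroup hU, i, ?_⟩
  refine (congrArg (conjDiag _ · i) hA.1.exists_eq_unitaryDiagonal).trans ?_
  rw [conjDiag_unitaryDiagonal, conjTranspose_mul_self_of_mem_unitaryGroup hU]
  simp [Matrix.one_apply, apply_ite Complex.normSq, le_antisymm hi (hA.eigenvalues_nonneg i)]

lemma Matrix.PosDef.exists_smul_one_le [NeZero n] {A : Matrix (Fin n) (Fin n) ℂ} (hA : A.PosDef) :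
    ∃ m : ℝ, 0 < m ∧ m • (1 : Matrix (Fin n) (Fin n) ℂ) ≤ A := by
  obtain ⟨U, hU, d, hd, rfl⟩ := hA.exists_eq_unitaryDiagonal
  obtain ⟨i₀, hi₀⟩ := Finite.exists_min d
  refine ⟨d i₀, hd i₀, ?_⟩
  rw [← unitaryDiagonal_one hU, smul_unitaryDiagonal, le_iff, unitaryDiagonal_sub]
  exact posSemidef_unitaryDiagonal U fun i => by simpa using hi₀ i

open scoped Matrix.Norms.L2Operator in
/-- Near a positive definite matrix, Hermitian matrices are squeezed between multiples of it. -/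
lemma Matrix.PosDef.exists_squeeze [NeZero n] {A : Matrix (Fin n) (Fin n) ℂ} (hA : A.PosDef) :
    ∃ t : Matrix (Fin n) (Fin n) ℂ → ℝ, Continuous t ∧ t A = 0 ∧
      ∀ B : Matrix (Fin n) (Fin n) ℂ, B.IsHermitian →
        0 ≤ t B ∧ (1 - t B) • A ≤ B ∧ B ≤ (1 + t B) • A := by
  obtain ⟨m, hm, hmA⟩ := hA.exists_smul_one_le
  -- Since `m • 1 ≤ A`, this `t` gives `‖B - A‖ • 1 ≤ t B • A`.
  refine ⟨fun B => ‖B - A‖ / m, by fun_prop, by simp, fun B hB => ?_⟩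
  have hsa : IsSelfAdjoint (B - A) := (hB.sub hA.1)
  have hle : algebraMap ℝ (Matrix (Fin n) (Fin n) ℂ) ‖B - A‖ ≤ (‖B - A‖ / m) • A := by
    rw [Algebra.algebraMap_eq_smul_one]
    calc ‖B - A‖ • (1 : Matrix (Fin n) (Fin n) ℂ)
        = (‖B - A‖ / m) • m • (1 : Matrix (Fin n) (Fin n) ℂ) := by
          rw [smul_smul, div_mul_cancel₀ _ hm.ne']
      _ ≤ _ := by
          rw [le_iff, ← smul_sub]
          exact (le_iff.1 hmA).smul (div_nonneg (norm_nonneg _) hm.le)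
  have h1 := hsa.le_algebraMap_norm_self.trans hle
  have h2 := (neg_le_neg hle).trans hsa.neg_algebraMap_norm_le_self
  refine ⟨div_nonneg (norm_nonneg _) hm.le, ?_, ?_⟩
  · rw [sub_smul, one_smul]
    simpa [sub_eq_add_neg, add_comm] using add_le_add_left h2 A
  · rw [add_smul, one_smul]
    exact sub_le_iff_le_add'.1 h1

lemma IsSymmetricNorm.continuousOn_derivedAntiNorm (hN : IsSymmetricNorm N) (hp : 0 < p) :
    ContinuousOn (derivedAntiNorm N p) {A | A.PosSemidef} := by
  rcases Nat.eq_zero_or_pos n with hn | hn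
  · rw [show derivedAntiNorm N p = fun _ => 0 from
      funext (derivedAntiNorm_of_eq_zero hp hn N)]
    exact continuousOn_const
  have : NeZero n := ⟨hn.ne'⟩
  intro A hA
  rw [ContinuousWithinAt]
  by_cases h : A.PosDef
  · obtain ⟨t, ht, htA, hsq⟩ := h.exists_squeeze
    -- Homogeneity needs the lower factor `1 - t B` to be nonnegative.
    have hlt : ∀ᶠ B in nhdsWithin A {A | A.PosSemidef}, t B < 1 :=
      nhdsWithin_le_nhds ((ht.tendsto A).eventually_lt_const (by rw [htA]; exact one_pos))
    have hlow : Filter.Tendsto (fun B => (1 - t B) * derivedAntiNorm N p A)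
        (nhdsWithin A {A | A.PosSemidef}) (nhds (derivedAntiNorm N p A)) := by
      have : Continuous fun B => (1 - t B) * derivedAntiNorm N p A := by fun_prop
      simpa [htA] using (this.tendsto A).mono_left nhdsWithin_le_nhds
    have hup : Filter.Tendsto (fun B => (1 + t B) * derivedAntiNorm N p A)
        (nhdsWithin A {A | A.PosSemidef}) (nhds (derivedAntiNorm N p A)) := by
      have : Continuous fun B => (1 + t B) * derivedAntiNorm N p A := by fun_prop
      simpa [htA] using (this.tendsto A).mono_left nhdsWithin_le_nhds
    refine tendsto_of_tendsto_of_tendsto_of_le_of_le' hlow hup ?_ ?_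
    · filter_upwards [hlt, self_mem_nhdsWithin] with B hB hBp
      rw [← derivedAntiNorm_smul hp hA (sub_nonneg.2 hB.le)]
      exact hN.derivedAntiNorm_mono hp (hA.smul (sub_nonneg.2 hB.le)) (hsq B hBp.1).2.1
    · filter_upwards [self_mem_nhdsWithin] with B hBp
      rw [← derivedAntiNorm_smul hp hA (add_nonneg zero_le_one (hsq B hBp.1).1)]
      exact hN.derivedAntiNorm_mono hp hBp (hsq B hBp.1).2.2
  · rw [derivedAntiNorm_of_not_posDef N p hA h]
    obtain ⟨W, hW, i, hi⟩ := hA.exists_conjDiag_eq_zero h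
    have hup : Filter.Tendsto
        (fun B => conjDiag W B i * N (diagonal (Pi.single i 1)) ^ (-1 / p))
        (nhdsWithin A {A | A.PosSemidef}) (nhds 0) := by
      have hc : Continuous fun B => conjDiag W B i := by
        unfold conjDiag
        exact Complex.continuous_re.comp (Continuous.matrix_elem (by fun_prop) i i)
      have := hc.mul_const (N (diagonal (Pi.single i 1)) ^ (-1 / p))
      simpa [hi] using (this.tendsto A).mono_left nhdsWithin_le_nhds
    refine tendsto_of_tendsto_of_tendsto_of_le_of_le' tendsto_const_nhds hup
      (Filter.Eventually.of_forall fun B => derivedAntiNorm_nonneg N p B) ?_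
    filter_upwards [self_mem_nhdsWithin] with B hB
    exact hN.derivedAntiNorm_le_conjDiag hp hB hW i

end DerivedAntiNorm

theorem proposition4p6 {n : ℕ} (N : Seminorm ℂ (Matrix (Fin n) (Fin n) ℂ))
    (hN : IsSymmetricNorm N) {p : ℝ} (hp : 0 < p) :
    IsSymmetricAntiNorm (derivedAntiNorm N p) where
  nonneg A _ := derivedAntiNorm_nonneg N p A
  continuousOn := hN.continuousOn_derivedAntiNorm hp
  homogeneous _ hA _ hr := derivedAntiNorm_smul hp hA hr
  unitarily_invariant _ hA _ hU := hN.derivedAntiNorm_conj hA hU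
  superadditive _ _ hA hB := hN.derivedAntiNorm_superadditive hp hA hB
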